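/- Consider a Markov decision process with finite state space $\mathcal S$, finite action space $\mathcal A$, initial state distribution $d$, transition probabilities $T(s'|s,a)$, discount factor $\gamma\in(0,1)$ and features $\phi:\mathcal S\times\mathcal A\to\mathbb R^k$. Let $\Pi$ be the set of stationary stochastic policies $\pi(a|s)$, and for $\pi\in\Pi$ and $f:\mathcal S\times\mathcal A\to\mathbb R$ put $\mathbb E_\pi[f(s,a)]=\mathbb E\big[\sum_{t\ge0}\gamma^t f(s_t,a_t)\,\big|\,\pi,d\big]$. Let $\pi_E\in\Pi$ be the expert's policy, $\Pi_E=\{\pi\in\Pi:\mathbb E_\pi[\phi(s,a)]=\mathbb E_{\pi_E}[\phi(s,a)]\}$ the set of policies that satisfy the feature-matching constraint, and $W(\pi)=\frac12\mathbb E_\pi[1-\pi(a|s)]$ the causal Tsallis entropy. For $\alpha>0$, a maximum causal Tsallis entropy (MCTE) policy is a maximizer of $\alpha W$ over $\Pi_E$. For $\pi,\tilde\pi\in\Pi$ put $$R(\tilde\pi,\pi)=\mathbb E_{\tilde\pi}\Big[\sum_{a'}\tfrac12\big(\mathbb 1_{\{a'=a\}}-\pi(a'|s)\big)^2\Big]$$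 (the expected discounted Brier score of the decision maker $\pi$ when nature plays $\tilde\pi$) and $R^*(\pi)=\max_{\tilde\pi\in\Pi_E}R(\tilde\pi,\pi)$ (this maximum is attained). Say that $\pi$ visits $s$ if $s$ is reached with positive probability under $\pi$. Then the following hold, where a robust Bayes policy is a minimizer of $R^*$, either over $\Pi_E$ or over $\Pi$ (each of the two readings): 1. Every MCTE policy that visits every state visited by some policy in $\Pi_E$ minimizes the worst-case Brier score $R^*$, both over $\Pi_E$ and over $\Pi$. Without this visiting condition, every MCTE policy can be changed at states that it does not visit so that the result is an MCTE policy that minimizes $R^*$ both over $\Pi_E$ and over $\Pi$. 2. Conversely, every minimizer of $R^*$ over $\Pi_E$, and every minimizer of $R^*$ over $\Pi$, is an MCTE policy. 3. For every $\tilde\pi\in\Pi$, $\min_{\pi\in\Pi}R(\tilde\pi,\pi)=R(\tilde\pi,\tilde\pi)=W(\tilde\pi)$, and the min-max problem reduces to maximizing $W$: $$\min_{\pi\in\Pi_E}\max_{\tilde\pi\in\Pi_E}R(\tilde\pi,\pi)=\min_{\pi\in\Pi}\max_{\tilde\pi\in\Pi_E}R(\tilde\pi,\pi)=\max_{\tilde\pi\in\Pi_E}W(\tilde\pi),$$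 all minima and maxima being attained. -/

import Mathlib

open MeasureTheory ProbabilityTheory

noncomputable section

namespace MCTE

/-- A finite Markov decision process without reward, with state space `S`, action space `A` and
`k` real-valued features: initial state distribution `d`, transition probabilities `T s a`
(a distribution on next states), discount factor `γ ∈ (0, 1)` and feature map `φ`. -/
structure MDP (S A : Type*) (k : ℕ) where
  d : PMF S
  T : S → A → PMF S
  γ : ℝ
  γ_pos : 0 < γ
  γ_lt_one : γ < 1
  φ : S → A → Fin k → ℝ

/-- Stochastic stationary policies: a probability distribution on actions for every state. -/
abbrev Policy (S A : Type*) := S → PMF A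

/-- The real number `π(a|s)`. -/
def Policy.prob {S A : Type*} (π : Policy S A) (s : S) (a : A) : ℝ := (π s a).toReal

variable {S A : Type*} {k : ℕ}

/-- Choose an action with the policy in a state drawn from `p`: the joint law of the pair. -/
def withAction (π : Policy S A) (p : PMF S) : PMF (S × A) :=
  p.bind fun s => (π s).map fun a => (s, a)

variable [Finite S] [Finite A] [MeasurableSpace S] [MeasurableSpace A]
  [MeasurableSingletonClass S] [MeasurableSingletonClass A]

/-- The transition kernel of the state-action process: given the history `(s₀,a₀),…,(sₙ,aₙ)`,
draw `sₙ₊₁` from `T(·|sₙ,aₙ)` and then `aₙ₊₁` from `π(·|sₙ₊₁)`. -/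
def stepKernel (M : MDP S A k) (π : Policy S A) (n : ℕ) :
    Kernel ((i : Finset.Iic n) → (fun _ : ℕ => S × A) i) (S × A) :=
  Kernel.ofFunOfCountable fun h =>
    (withAction π
      (M.T (h ⟨n, Finset.mem_Iic.2 le_rfl⟩).1 (h ⟨n, Finset.mem_Iic.2 le_rfl⟩).2)).toMeasure

instance (M : MDP S A k) (π : Policy S A) (n : ℕ) : IsMarkovKernel (stepKernel M π n) :=
  ⟨fun _ => PMF.toMeasure.isProbabilityMeasure _⟩

/-- The law of the trajectory `(s₀,a₀),(s₁,a₁),…` under the policy `π`, with `s₀ ∼ d`. -/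
def trajLaw (M : MDP S A k) (π : Policy S A) : Measure (ℕ → S × A) :=
  Kernel.trajMeasure (X := fun _ => S × A) (withAction π M.d).toMeasure (stepKernel M π)

/-- The expected discounted sum `E_π[f(s,a)] = E[∑ₜ γᵗ f(sₜ,aₜ) | π, d]`. -/
def expect (M : MDP S A k) (π : Policy S A) (f : S → A → ℝ) : ℝ :=
  ∫ ω, ∑' t : ℕ, M.γ ^ t * f (ω t).1 (ω t).2 ∂(trajLaw M π)

open Classical in
/-- The (discounted) state visitation `ρ_π(s) = E[∑ₜ γᵗ 1{sₜ = s} | π, d]`; it is positive if and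
only if `s` is reached with positive probability under `π`. -/
def visitation (M : MDP S A k) (π : Policy S A) (s : S) : ℝ :=
  expect M π fun s' _ => if s' = s then 1 else 0

/-- The causal Tsallis entropy `W(π) = (1/2) E_π[1 - π(a|s)]`. -/
def tsallis (M : MDP S A k) (π : Policy S A) : ℝ :=
  (1 / 2) * expect M π fun s a => 1 - π.prob s a

/-- The policies whose expected discounted features match those of the expert `πE`. -/
def Matching (M : MDP S A k) (πE : Policy S A) : Set (Policy S A) :=
  {π | ∀ j, expect M π (fun s a => M.φ s a j) = expect M πE (fun s a => M.φ s a j)}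

/-- `π` is a maximum causal Tsallis entropy policy: it maximizes `α W` among the policies that
satisfy the feature-matching constraint. -/
def IsMCTE (M : MDP S A k) (πE : Policy S A) (α : ℝ) (π : Policy S A) : Prop :=
  π ∈ Matching M πE ∧ ∀ π' ∈ Matching M πE, α * tsallis M π' ≤ α * tsallis M π

open Classical in
/-- The Brier score of the prediction `π(·|s)` when the action `a` occurs. -/
def brier {S A : Type*} [Fintype A] (π : Policy S A) (s : S) (a : A) : ℝ :=
  ∑ a' : A, (1 / 2) * ((if a' = a then 1 else 0) - π.prob s a') ^ 2

/-- The expected discounted Brier score `E_{π'}[brier π]` of the decision maker's policy `π` when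
the nature plays `π'`. -/
def brierRisk {S A : Type*} {k : ℕ} [Finite S] [Fintype A] [MeasurableSpace S] [MeasurableSpace A]
    [MeasurableSingletonClass S] [MeasurableSingletonClass A]
    (M : MDP S A k) (π' π : Policy S A) : ℝ :=
  expect M π' (brier π)

/-- The worst-case expected discounted Brier score of `π`, over the nature's policies that satisfy
the feature-matching constraint. -/
def worstBrier {S A : Type*} {k : ℕ} [Finite S] [Fintype A] [MeasurableSpace S]
    [MeasurableSpace A] [MeasurableSingletonClass S] [MeasurableSingletonClass A]
    (M : MDP S A k) (πE π : Policy S A) : ℝ :=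
  sSup ((fun π' => brierRisk M π' π) '' Matching M πE)

/-- `π` solves the robust-Bayes problem with decision set `C`: it lies in `C` and minimizes the
worst-case expected discounted Brier score over `C`. -/
def IsRobustBayes {S A : Type*} {k : ℕ} [Finite S] [Fintype A] [MeasurableSpace S]
    [MeasurableSpace A] [MeasurableSingletonClass S] [MeasurableSingletonClass A]
    (M : MDP S A k) (πE : Policy S A) (C : Set (Policy S A)) (π : Policy S A) : Prop :=
  π ∈ C ∧ ∀ π' ∈ C, worstBrier M πE π ≤ worstBrier M πE π'

end MCTE

end

/-! Completing the square shows that the Brier risk is the entropy `W` of nature's policy plus half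
the squared distance between the two policies, weighted by nature's visitation
(`brierRisk_eq_tsallis_add`). So `W` is the least risk against a known nature, attained exactly by
the policies that agree with nature's where it visits.

The risk is convex in the decision maker's policy and linear in nature's occupancy. The occupancies
of matching policies form a compact convex polytope (`occupancy_image_matching`), so Sion's theorem
gives a saddle point `(π₁, π₂)`, with `π₁` ranging over all policies. Testing it at `π₂` bounds
every risk of `π₁` by `W(π₂)`; hence `π₂` has maximal entropy, which is the min-max value.

Any policy whose worst-case risk is at most this value agrees with each entropy maximizer where the
maximizer visits, so it has the same occupancy, matches the features and maximizes entropy too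
(`isMCTE_of_worstBrier_le`). This yields the converse and identifies the two readings; `π₁` itself
is the required modification of every maximizer. -/

namespace MCTE

/-! ### Marginals of the trajectory law and discounted occupancies. -/

section Marginals

variable {S A : Type*} {k : ℕ}

lemma withAction_apply (π : Policy S A) (p : PMF S) (s : S) (a : A) :
    withAction π p (s, a) = p s * π s a := by
  classical
  rw [withAction, PMF.bind_apply, tsum_eq_single s]
  · rw [PMF.map_apply, tsum_eq_single a]
    · simp
    · intro b hb
      simp [hb.symm]
  · intro s' hs'
    rw [PMF.map_apply]
    simp [hs'.symm]

lemma Policy.prob_nonneg (π : Policy S A) (s : S) (a : A) : 0 ≤ π.prob s a :=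
  ENNReal.toReal_nonneg

lemma toReal_sum_pmf {X : Type*} [Fintype X] (p : PMF X) : ∑ x, (p x).toReal = 1 := by
  rw [← ENNReal.toReal_sum fun x _ => p.apply_ne_top x, ← tsum_fintype (L := .unconditional X),
    p.tsum_coe, ENNReal.toReal_one]

lemma Policy.sum_prob [Fintype A] (π : Policy S A) (s : S) : ∑ a, π.prob s a = 1 :=
  toReal_sum_pmf (π s)

variable [Finite S] [Finite A] [MeasurableSpace S] [MeasurableSpace A]
  [MeasurableSingletonClass S] [MeasurableSingletonClass A]

instance (M : MDP S A k) (π : Policy S A) : IsProbabilityMeasure (trajLaw M π) := by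
  unfold trajLaw
  infer_instance

lemma trajLaw_map_zero (M : MDP S A k) (π : Policy S A) :
    (trajLaw M π).map (fun ω => ω 0) = (withAction π M.d).toMeasure := by
  have h : (fun ω : ℕ → S × A => ω 0) =
      (fun h : (i : Finset.Iic 0) → (fun _ : ℕ => S × A) i => h ⟨0, Finset.mem_Iic.2 le_rfl⟩) ∘
        Preorder.frestrictLe 0 := rfl
  rw [h, ← Measure.map_map (by fun_prop) (by fun_prop), trajLaw, Kernel.trajMeasure,
    Measure.map_comp _ _ (by fun_prop), Kernel.traj_map_frestrictLe, Kernel.partialTraj_self,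
    Measure.id_comp, Measure.map_map (by fun_prop) (by fun_prop)]
  exact Measure.map_id

/-- The step kernel reads only the last pair of the history, so disintegrating the law up to time `t
+ 1` leaves a recursion between one-time marginals. -/
lemma trajLaw_succ [Fintype S] [Fintype A] (M : MDP S A k) (π : Policy S A) (t : ℕ) (y : S × A) :
    trajLaw M π ((fun ω => ω (t + 1)) ⁻¹' {y}) =
      ∑ x : S × A, withAction π (M.T x.1 x.2) y * trajLaw M π ((fun ω => ω t) ⁻¹' {x}) := by
  have h := Kernel.map_frestrictLe_trajMeasure_compProd_eq_map_trajMeasure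
    (X := fun _ => S × A) (μ₀ := (withAction π M.d).toMeasure) (κ := stepKernel M π) (a := t)
  change (trajLaw M π).map (Preorder.frestrictLe t) ⊗ₘ stepKernel M π t =
    (trajLaw M π).map _ at h
  have h2 := congrArg (fun μ => μ (Set.univ ×ˢ {y})) h
  rw [Measure.map_apply (by fun_prop) (MeasurableSet.univ.prod (measurableSet_singleton y)),
    Measure.compProd_apply_prod MeasurableSet.univ (measurableSet_singleton y),
    Measure.restrict_univ, lintegral_map (Kernel.measurable_coe _ (measurableSet_singleton y))
      (by fun_prop)] at h2
  have e1 : (fun x : ℕ → S × A => (Preorder.frestrictLe (π := fun _ => S × A) t x, x (t + 1))) ⁻¹'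
      Set.univ ×ˢ {y} = (fun ω => ω (t + 1)) ⁻¹' {y} := by
    ext; simp
  rw [e1] at h2
  rw [← h2]
  have e2 : ∀ ω : ℕ → S × A, stepKernel M π t (Preorder.frestrictLe (π := fun _ => S × A) t ω) {y} =
      withAction π (M.T (ω t).1 (ω t).2) y := fun ω => by
    change (withAction π (M.T (ω t).1 (ω t).2)).toMeasure {y} = _
    exact PMF.toMeasure_apply_singleton _ _ (measurableSet_singleton y)
  simp_rw [e2]
  rw [← lintegral_map (μ := trajLaw M π)
    (f := fun x : S × A => withAction π (M.T x.1 x.2) y) (g := fun ω => ω t)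
    (measurable_of_countable _) (by fun_prop), lintegral_fintype]
  exact Finset.sum_congr rfl fun x _ => by
    rw [Measure.map_apply (by fun_prop) (measurableSet_singleton x)]

/-- The probability of the state-action pair `(s, a)` at time `t`. -/
noncomputable def pairProb (M : MDP S A k) (π : Policy S A) (t : ℕ) (s : S) (a : A) : ℝ :=
  (trajLaw M π).real ((fun ω => ω t) ⁻¹' {(s, a)})

/-- The discounted state-action occupancy `∑ₜ γᵗ P(sₜ = s, aₜ = a)`. -/
noncomputable def occupancy (M : MDP S A k) (π : Policy S A) (s : S) (a : A) : ℝ :=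
  ∑' t : ℕ, M.γ ^ t * pairProb M π t s a

lemma pairProb_nonneg (M : MDP S A k) (π : Policy S A) (t : ℕ) (s : S) (a : A) :
    0 ≤ pairProb M π t s a := measureReal_nonneg

lemma pairProb_le_one (M : MDP S A k) (π : Policy S A) (t : ℕ) (s : S) (a : A) :
    pairProb M π t s a ≤ 1 := measureReal_le_one

lemma pairProb_zero (M : MDP S A k) (π : Policy S A) (s : S) (a : A) :
    pairProb M π 0 s a = (M.d s).toReal * π.prob s a := by
  have h := congrArg (fun μ => μ {(s, a)}) (trajLaw_map_zero M π)
  rw [Measure.map_apply (by fun_prop) (measurableSet_singleton _),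
    PMF.toMeasure_apply_singleton _ _ (measurableSet_singleton _), withAction_apply] at h
  rw [pairProb, measureReal_def, h, ENNReal.toReal_mul, Policy.prob]

lemma pairProb_succ [Fintype S] [Fintype A] (M : MDP S A k) (π : Policy S A) (t : ℕ)
    (s : S) (a : A) :
    pairProb M π (t + 1) s a =
      (∑ s', ∑ a', pairProb M π t s' a' * (M.T s' a' s).toReal) * π.prob s a := by
  rw [pairProb, measureReal_def, trajLaw_succ, ENNReal.toReal_sum, Fintype.sum_prod_type,
    Finset.sum_mul]
  · refine Finset.sum_congr rfl fun s' _ => ?_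
    rw [Finset.sum_mul]
    refine Finset.sum_congr rfl fun a' _ => ?_
    rw [withAction_apply, ENNReal.toReal_mul, ENNReal.toReal_mul, pairProb, measureReal_def,
      Policy.prob]
    ring
  · intro x _
    exact ENNReal.mul_ne_top (PMF.apply_ne_top _ _) (measure_ne_top _ _)

lemma summable_pairProb (M : MDP S A k) (π : Policy S A) (s : S) (a : A) :
    Summable fun t : ℕ => M.γ ^ t * pairProb M π t s a := by
  refine Summable.of_nonneg_of_le
    (fun t => mul_nonneg (pow_nonneg M.γ_pos.le t) (pairProb_nonneg M π t s a)) (fun t => ?_)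
    (summable_geometric_of_lt_one M.γ_pos.le M.γ_lt_one)
  exact mul_le_of_le_one_right (pow_nonneg M.γ_pos.le t) (pairProb_le_one M π t s a)

lemma occupancy_nonneg (M : MDP S A k) (π : Policy S A) (s : S) (a : A) :
    0 ≤ occupancy M π s a :=
  tsum_nonneg fun t => mul_nonneg (pow_nonneg M.γ_pos.le t) (pairProb_nonneg M π t s a)

lemma integral_pair [Fintype S] [Fintype A] (M : MDP S A k) (π : Policy S A) (t : ℕ)
    (f : S → A → ℝ) :
    ∫ ω, f (ω t).1 (ω t).2 ∂(trajLaw M π) = ∑ s, ∑ a, pairProb M π t s a * f s a := by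
  have : IsProbabilityMeasure ((trajLaw M π).map fun ω => ω t) :=
    Measure.isProbabilityMeasure_map (measurable_pi_apply t).aemeasurable
  rw [← integral_map (μ := trajLaw M π) (φ := fun ω => ω t) (f := fun x : S × A => f x.1 x.2)
    (measurable_pi_apply t).aemeasurable (measurable_of_countable _).aestronglyMeasurable,
    integral_fintype .of_finite, Fintype.sum_prod_type]
  refine Finset.sum_congr rfl fun s _ => Finset.sum_congr rfl fun a _ => ?_
  rw [measureReal_def, Measure.map_apply (by fun_prop) (measurableSet_singleton _)]
  rfl

/-- Since `f` is bounded, a geometric series dominates and sum and integral commute. From here on a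
policy enters expectations only through its occupancy. -/
lemma expect_eq_sum [Fintype S] [Fintype A] (M : MDP S A k) (π : Policy S A) (f : S → A → ℝ) :
    expect M π f = ∑ s, ∑ a, occupancy M π s a * f s a := by
  have hmeas : ∀ t, Measurable fun ω : ℕ → S × A => f (ω t).1 (ω t).2 := fun t =>
    (measurable_of_countable fun x : S × A => f x.1 x.2).comp (measurable_pi_apply t)
  obtain ⟨C, hC⟩ : ∃ C, ∀ x : S × A, ‖f x.1 x.2‖ ≤ C :=
    ⟨∑ y : S × A, ‖f y.1 y.2‖, fun x =>
      Finset.single_le_sum (f := fun y : S × A => ‖f y.1 y.2‖)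
        (fun y _ => norm_nonneg _) (Finset.mem_univ x)⟩
  have hint : ∀ t, Integrable (fun ω : ℕ → S × A => M.γ ^ t * f (ω t).1 (ω t).2)
      (trajLaw M π) := fun t =>
    (Integrable.of_bound (hmeas t).aestronglyMeasurable C
      (ae_of_all _ fun ω => hC (ω t))).const_mul _
  rw [expect, ← integral_tsum_of_summable_integral_norm hint]
  · simp_rw [integral_const_mul, integral_pair, Finset.mul_sum, ← mul_assoc]
    have hs : ∀ s a, Summable fun t : ℕ => M.γ ^ t * pairProb M π t s a * f s a :=
      fun s a => (summable_pairProb M π s a).mul_right _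
    rw [Summable.tsum_finsetSum fun s _ => summable_sum fun a _ => hs s a]
    refine Finset.sum_congr rfl fun s _ => ?_
    rw [Summable.tsum_finsetSum fun a _ => hs s a]
    refine Finset.sum_congr rfl fun a _ => ?_
    rw [tsum_mul_right, occupancy]
  · refine Summable.of_nonneg_of_le (fun t => integral_nonneg fun ω => norm_nonneg _) (fun t => ?_)
      ((summable_geometric_of_lt_one M.γ_pos.le M.γ_lt_one).mul_right C)
    have hb : ∀ ω : ℕ → S × A, ‖M.γ ^ t * f (ω t).1 (ω t).2‖ ≤ M.γ ^ t * C := fun ω => by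
      rw [norm_mul, Real.norm_of_nonneg (pow_nonneg M.γ_pos.le t)]
      exact mul_le_mul_of_nonneg_left (hC (ω t)) (pow_nonneg M.γ_pos.le t)
    calc ∫ ω, ‖M.γ ^ t * f (ω t).1 (ω t).2‖ ∂(trajLaw M π)
        ≤ ∫ _, M.γ ^ t * C ∂(trajLaw M π) :=
          integral_mono (hint t).norm (integrable_const _) hb
      _ = M.γ ^ t * C := by simp

lemma visitation_eq_sum [Fintype A] (M : MDP S A k) (π : Policy S A) (s : S) :
    visitation M π s = ∑ a, occupancy M π s a := by
  classical
  cases nonempty_fintype S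
  rw [visitation, expect_eq_sum]
  simp

lemma visitation_nonneg (M : MDP S A k) (π : Policy S A) (s : S) : 0 ≤ visitation M π s := by
  cases nonempty_fintype A
  rw [visitation_eq_sum]
  exact Finset.sum_nonneg fun a _ => occupancy_nonneg M π s a

/-- Split off time 0 and apply the one-step recursion to the remaining terms. -/
lemma occupancy_eq [Fintype S] [Fintype A] (M : MDP S A k) (π : Policy S A) (s : S) (a : A) :
    occupancy M π s a = ((M.d s).toReal +
      M.γ * ∑ s', ∑ a', occupancy M π s' a' * (M.T s' a' s).toReal) * π.prob s a := by
  have hs : ∀ s' a', Summable fun t : ℕ =>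
      M.γ ^ t * pairProb M π t s' a' * (M.T s' a' s).toReal :=
    fun s' a' => (summable_pairProb M π s' a').mul_right _
  rw [occupancy, (summable_pairProb M π s a).tsum_eq_zero_add, pairProb_zero, pow_zero, one_mul,
    add_mul]
  congr 1
  calc ∑' t : ℕ, M.γ ^ (t + 1) * pairProb M π (t + 1) s a
      = ∑' t : ℕ, (∑ s', ∑ a', M.γ ^ t * pairProb M π t s' a' * (M.T s' a' s).toReal) *
          (M.γ * π.prob s a) := by
        refine tsum_congr fun t => ?_
        simp_rw [pairProb_succ, mul_assoc, ← Finset.mul_sum]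
        ring
    _ = _ := by
        rw [tsum_mul_right, Summable.tsum_finsetSum fun s' _ => summable_sum fun a' _ => hs s' a']
        simp_rw [Summable.tsum_finsetSum fun a' (_ : a' ∈ Finset.univ) => hs _ a',
          tsum_mul_right, occupancy]
        ring

lemma visitation_eq [Fintype S] [Fintype A] (M : MDP S A k) (π : Policy S A) (s : S) :
    visitation M π s = (M.d s).toReal +
      M.γ * ∑ s', ∑ a', occupancy M π s' a' * (M.T s' a' s).toReal := by
  rw [visitation_eq_sum, Finset.sum_congr rfl fun a _ => occupancy_eq M π s a, ← Finset.mul_sum,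
    π.sum_prob, mul_one]

lemma occupancy_eq_visitation_mul (M : MDP S A k) (π : Policy S A)
    (s : S) (a : A) : occupancy M π s a = visitation M π s * π.prob s a := by
  cases nonempty_fintype S
  cases nonempty_fintype A
  rw [visitation_eq, ← occupancy_eq]

end Marginals

/-! ### Policies as points of a product of simplices. -/

section Simplex

variable {S A : Type*} [Fintype A]

lemma exists_pmf_toReal_eq {q : A → ℝ} (hq : q ∈ stdSimplex ℝ A) :
    ∃ p : PMF A, ∀ a, (p a).toReal = q a := by
  refine ⟨PMF.ofFintype (fun a => ENNReal.ofReal (q a)) ?_, fun a => ?_⟩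
  · rw [← ENNReal.ofReal_sum_of_nonneg fun a _ => hq.1 a, hq.2, ENNReal.ofReal_one]
  · rw [PMF.ofFintype_apply, ENNReal.toReal_ofReal (hq.1 a)]

/-- Stochastic policies as families of points of the standard simplex. -/
def policySimplex (S A : Type*) [Fintype A] : Set (S → A → ℝ) :=
  Set.univ.pi fun _ => stdSimplex ℝ A

lemma Policy.prob_mem_policySimplex (π : Policy S A) : π.prob ∈ policySimplex S A :=
  fun s _ => ⟨π.prob_nonneg s, π.sum_prob s⟩

lemma exists_policy_prob_eq {p : S → A → ℝ} (hp : p ∈ policySimplex S A) :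
    ∃ π : Policy S A, π.prob = p := by
  choose π hπ using fun s => exists_pmf_toReal_eq (hp s (Set.mem_univ s))
  exact ⟨π, funext fun s => funext fun a => hπ s a⟩

lemma isCompact_policySimplex : IsCompact (policySimplex S A) :=
  isCompact_univ_pi fun _ => isCompact_stdSimplex ℝ A

lemma convex_policySimplex : Convex ℝ (policySimplex S A) :=
  convex_pi fun _ _ => convex_stdSimplex ℝ A

end Simplex

/-! ### Bellman flow equations and the polytope of occupancies. -/

section Flow

variable {S A : Type*} {k : ℕ} [Fintype S] [Fintype A]

/-- The Bellman flow equations for a state-action occupancy. -/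
def IsFlow (M : MDP S A k) (x : S → A → ℝ) : Prop :=
  ∀ s, ∑ a, x s a = (M.d s).toReal + M.γ * ∑ s', ∑ a', x s' a' * (M.T s' a' s).toReal

lemma sum_sum_mul_transition (M : MDP S A k) (x : S → A → ℝ) :
    ∑ s, ∑ s', ∑ a', x s' a' * (M.T s' a' s).toReal = ∑ s', ∑ a', x s' a' := by
  rw [Finset.sum_comm]
  refine Finset.sum_congr rfl fun s' _ => ?_
  rw [Finset.sum_comm]
  refine Finset.sum_congr rfl fun a' _ => ?_
  rw [← Finset.mul_sum, toReal_sum_pmf, mul_one]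

/-- Summing the flow equations over states removes the transitions. The fixed total mass is what
bounds the polytope. -/
lemma IsFlow.one_sub_mul_sum {M : MDP S A k} {x : S → A → ℝ} (hx : IsFlow M x) :
    (1 - M.γ) * ∑ s, ∑ a, x s a = 1 := by
  have h : ∑ s, ∑ a, x s a = 1 + M.γ * ∑ s, ∑ a, x s a := by
    conv_lhs => rw [Finset.sum_congr rfl fun s _ => hx s]
    rw [Finset.sum_add_distrib, toReal_sum_pmf, ← Finset.mul_sum, sum_sum_mul_transition]
  linarith

/-- The nonnegative solutions of the Bellman flow equations with given feature expectations. -/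
def flowPolytope (M : MDP S A k) (c : Fin k → ℝ) : Set (S → A → ℝ) :=
  {x | (∀ s a, 0 ≤ x s a) ∧ IsFlow M x ∧ ∀ j, ∑ s, ∑ a, x s a * M.φ s a j = c j}

lemma convex_flowPolytope (M : MDP S A k) (c : Fin k → ℝ) : Convex ℝ (flowPolytope M c) := by
  have key : ∀ (x y : S → A → ℝ) (u v : ℝ) (w : S → A → ℝ),
      ∑ s, ∑ a, (u • x + v • y) s a * w s a =
        u * ∑ s, ∑ a, x s a * w s a + v * ∑ s, ∑ a, y s a * w s a := by
    intro x y u v w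
    simp_rw [Finset.mul_sum, ← Finset.sum_add_distrib]
    refine Finset.sum_congr rfl fun s _ => Finset.sum_congr rfl fun a _ => ?_
    simp only [Pi.add_apply, Pi.smul_apply, smul_eq_mul]
    ring
  rintro x ⟨hx0, hxf, hxc⟩ y ⟨hy0, hyf, hyc⟩ u v hu hv huv
  refine ⟨fun s a => ?_, fun s => ?_, fun j => ?_⟩
  · exact add_nonneg (mul_nonneg hu (hx0 s a)) (mul_nonneg hv (hy0 s a))
  · have h1 : ∑ a, (u • x + v • y) s a = u * ∑ a, x s a + v * ∑ a, y s a := by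
      simp only [Pi.add_apply, Pi.smul_apply, smul_eq_mul, Finset.sum_add_distrib, Finset.mul_sum]
    rw [h1, key x y u v fun s' a' => (M.T s' a' s).toReal, hxf s, hyf s]
    linear_combination (M.d s).toReal * huv
  · rw [key x y u v fun s a => M.φ s a j, hxc, hyc, ← add_mul, huv, one_mul]

lemma isCompact_flowPolytope (M : MDP S A k) (c : Fin k → ℝ) :
    IsCompact (flowPolytope M c) := by
  have hclosed : IsClosed (flowPolytope M c) := by
    have h : flowPolytope M c = (⋂ s, ⋂ a, {x | 0 ≤ x s a}) ∩ ((⋂ s, {x | ∑ a, x s a =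
        (M.d s).toReal + M.γ * ∑ s', ∑ a', x s' a' * (M.T s' a' s).toReal}) ∩
        ⋂ j, {x | ∑ s, ∑ a, x s a * M.φ s a j = c j}) := by
      ext x
      simp [flowPolytope, IsFlow]
    rw [h]
    refine (isClosed_iInter fun s => isClosed_iInter fun a => isClosed_le (by fun_prop)
      (by fun_prop)).inter ((isClosed_iInter fun s => isClosed_eq (by fun_prop)
      (by fun_prop)).inter (isClosed_iInter fun j => isClosed_eq (by fun_prop) (by fun_prop)))
  refine (isCompact_Icc (a := (0 : S → A → ℝ)) (b := fun _ _ => 1 / (1 - M.γ))).of_isClosed_subset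
    hclosed ?_
  rintro x ⟨hx0, hxf, -⟩
  refine ⟨fun s a => hx0 s a, fun s a => ?_⟩
  have hγ : 0 < 1 - M.γ := sub_pos.2 M.γ_lt_one
  change x s a ≤ 1 / (1 - M.γ)
  rw [le_div_iff₀ hγ, mul_comm]
  refine (mul_le_mul_of_nonneg_left ?_ hγ.le).trans_eq hxf.one_sub_mul_sum
  exact (Finset.single_le_sum (fun b _ => hx0 s b) (Finset.mem_univ a)).trans
    (Finset.single_le_sum (f := fun t => ∑ b, x t b)
      (fun t _ => Finset.sum_nonneg fun b _ => hx0 t b) (Finset.mem_univ s))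

variable [MeasurableSpace S] [MeasurableSpace A]
  [MeasurableSingletonClass S] [MeasurableSingletonClass A]

lemma isFlow_occupancy (M : MDP S A k) (π : Policy S A) : IsFlow M (occupancy M π) := fun s => by
  rw [← visitation_eq_sum, visitation_eq]

/-- A solution of the flow equations whose conditional action probabilities are those of `π` is
the occupancy of `π`. -/
lemma IsFlow.eq_occupancy {M : MDP S A k} {π : Policy S A} {x : S → A → ℝ} (hx : IsFlow M x)
    (hπ : ∀ s a, x s a = (∑ b, x s b) * π.prob s a) : x = occupancy M π := by
  -- The difference solves the homogeneous flow equations and still factors through `π`.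
  set z : S → A → ℝ := fun s a => x s a - occupancy M π s a with hz
  have hsum : ∀ s, ∑ a, z s a = M.γ * ∑ s', ∑ a', z s' a' * (M.T s' a' s).toReal := fun s => by
    simp only [hz, sub_mul, Finset.sum_sub_distrib]
    rw [hx s, isFlow_occupancy M π s]
    ring
  have hz' : ∀ s a, z s a = (∑ b, z s b) * π.prob s a := fun s a => by
    simp only [hz, Finset.sum_sub_distrib]
    rw [hπ s a, occupancy_eq_visitation_mul, visitation_eq_sum]
    ring
  -- At a fixed state all `z s a` have one sign, so nothing cancels; the flow equation then
  -- contracts the ℓ¹ norm by `γ < 1`, forcing `z = 0`.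
  have habs : ∀ s, ∑ a, |z s a| = |∑ a, z s a| := fun s => by
    conv_lhs => rw [Finset.sum_congr rfl fun a _ => congrArg abs (hz' s a)]
    simp_rw [abs_mul, abs_of_nonneg (π.prob_nonneg s _)]
    rw [← Finset.mul_sum, π.sum_prob, mul_one]
  have hle : ∑ s, ∑ a, |z s a| ≤ M.γ * ∑ s, ∑ a, |z s a| := by
    calc ∑ s, ∑ a, |z s a|
        ≤ ∑ s, M.γ * ∑ s', ∑ a', |z s' a'| * (M.T s' a' s).toReal := by
          refine Finset.sum_le_sum fun s _ => ?_
          rw [habs, hsum, abs_mul, abs_of_pos M.γ_pos]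
          refine mul_le_mul_of_nonneg_left ?_ M.γ_pos.le
          refine (Finset.abs_sum_le_sum_abs _ _).trans (Finset.sum_le_sum fun s' _ => ?_)
          refine (Finset.abs_sum_le_sum_abs _ _).trans (Finset.sum_le_sum fun a' _ => ?_)
          rw [abs_mul, abs_of_nonneg (ENNReal.toReal_nonneg (a := M.T s' a' s))]
      _ = _ := by
          rw [← Finset.mul_sum, sum_sum_mul_transition M fun s a => |z s a|]
  have hnn : ∀ s, 0 ≤ ∑ a, |z s a| := fun s => Finset.sum_nonneg fun a _ => abs_nonneg _
  have h0 : ∑ s, ∑ a, |z s a| = 0 := by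
    have := Finset.sum_nonneg fun s (_ : s ∈ Finset.univ) => hnn s
    nlinarith [M.γ_lt_one]
  funext s a
  have h1 := (Finset.sum_eq_zero_iff_of_nonneg fun s _ => hnn s).1 h0 s (Finset.mem_univ s)
  have h2 := (Finset.sum_eq_zero_iff_of_nonneg fun a _ => abs_nonneg _).1 h1 a (Finset.mem_univ a)
  exact sub_eq_zero.1 (abs_eq_zero.1 h2)

/-- Every nonnegative solution of the flow equations is the occupancy of a policy; the policy `π₀`
fills in the states of zero occupancy. -/
lemma IsFlow.exists_policy {M : MDP S A k} {x : S → A → ℝ} (hx : IsFlow M x)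
    (hx0 : ∀ s a, 0 ≤ x s a) (π₀ : Policy S A) : ∃ π : Policy S A, occupancy M π = x := by
  classical
  have hm : ∀ s, 0 ≤ ∑ a, x s a := fun s => Finset.sum_nonneg fun a _ => hx0 s a
  have hp : (fun s a => if ∑ b, x s b = 0 then π₀.prob s a else x s a / ∑ b, x s b) ∈
      policySimplex S A := by
    intro s _
    by_cases h : ∑ b, x s b = 0
    · simpa only [h, if_true] using π₀.prob_mem_policySimplex s (Set.mem_univ s)
    · simp only [h, if_false]
      exact ⟨fun a => div_nonneg (hx0 s a) (hm s), by rw [← Finset.sum_div, div_self h]⟩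
  obtain ⟨π, hπ⟩ := exists_policy_prob_eq hp
  refine ⟨π, (hx.eq_occupancy fun s a => ?_).symm⟩
  rw [hπ]
  by_cases h : ∑ b, x s b = 0
  · rw [h, zero_mul]
    exact (Finset.sum_eq_zero_iff_of_nonneg fun b _ => hx0 s b).1 h a (Finset.mem_univ a)
  · simp only [h, if_false]
    rw [mul_div_cancel₀ _ h]

lemma mem_matching_iff (M : MDP S A k) (πE π : Policy S A) :
    π ∈ Matching M πE ↔ occupancy M π ∈
      flowPolytope M fun j => expect M πE fun s a => M.φ s a j := by
  have h : ∀ j, expect M π (fun s a => M.φ s a j) =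
      ∑ s, ∑ a, occupancy M π s a * M.φ s a j := fun j => expect_eq_sum _ _ _
  simp only [Matching, flowPolytope, Set.mem_ofPred_eq, h]
  exact ⟨fun hπ => ⟨occupancy_nonneg M π, isFlow_occupancy M π, hπ⟩, fun hπ => hπ.2.2⟩

/-- Matching policies need not form a convex set; their occupancies do, which makes a minimax
theorem applicable. -/
lemma occupancy_image_matching (M : MDP S A k) (πE : Policy S A) :
    occupancy M '' Matching M πE = flowPolytope M fun j => expect M πE fun s a => M.φ s a j := by
  ext x
  constructor
  · rintro ⟨π, hπ, rfl⟩
    exact (mem_matching_iff M πE π).1 hπ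
  · intro hx
    obtain ⟨π, rfl⟩ := hx.2.1.exists_policy hx.1 πE
    exact ⟨π, (mem_matching_iff M πE π).2 hx, rfl⟩

end Flow

/-! ### The Brier score as a convex-linear function of prediction and occupancy. -/

section Score

variable {S A : Type*} [Fintype S] [Fintype A]

/-- The expected Brier score of the prediction `p` under the state-action occupancy `x`. -/
noncomputable def occupancyScore (p x : S → A → ℝ) : ℝ :=
  ∑ s, ∑ a, x s a * (1 / 2 * (1 - 2 * p s a + ∑ b, p s b ^ 2))

lemma occupancyScore_combo (p x y : S → A → ℝ) (u v : ℝ) :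
    occupancyScore p (u • x + v • y) = u * occupancyScore p x + v * occupancyScore p y := by
  simp_rw [occupancyScore, Finset.mul_sum, ← Finset.sum_add_distrib]
  refine Finset.sum_congr rfl fun s _ => Finset.sum_congr rfl fun a _ => ?_
  simp only [Pi.add_apply, Pi.smul_apply, smul_eq_mul]
  ring

lemma concaveOn_occupancyScore (p : S → A → ℝ) {K : Set (S → A → ℝ)} (hK : Convex ℝ K) :
    ConcaveOn ℝ K (occupancyScore p) :=
  ⟨hK, fun x _ y _ u v _ _ _ => (occupancyScore_combo p x y u v).ge⟩

lemma convexOn_occupancyScore {x : S → A → ℝ} (hx : ∀ s a, 0 ≤ x s a) {K : Set (S → A → ℝ)}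
    (hK : Convex ℝ K) : ConvexOn ℝ K fun p => occupancyScore p x := by
  refine ⟨hK, fun p _ q _ u v hu hv huv => ?_⟩
  simp only [occupancyScore, smul_eq_mul]
  rw [Finset.mul_sum, Finset.mul_sum, ← Finset.sum_add_distrib]
  refine Finset.sum_le_sum fun s _ => ?_
  rw [Finset.mul_sum, Finset.mul_sum, ← Finset.sum_add_distrib]
  refine Finset.sum_le_sum fun a _ => ?_
  have hsq : ∑ b, (u • p + v • q) s b ^ 2 ≤ u * ∑ b, p s b ^ 2 + v * ∑ b, q s b ^ 2 := by
    rw [Finset.mul_sum, Finset.mul_sum, ← Finset.sum_add_distrib]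
    refine Finset.sum_le_sum fun b _ => ?_
    simp only [Pi.add_apply, Pi.smul_apply, smul_eq_mul]
    obtain rfl : v = 1 - u := by linarith
    -- The convexity gap of the square is exactly `u (1 - u) (p s b - q s b) ^ 2`.
    nlinarith [mul_nonneg (mul_nonneg hu hv) (sq_nonneg (p s b - q s b))]
  have hlin : (u • p + v • q) s a = u * p s a + v * q s a := rfl
  calc x s a * (1 / 2 * (1 - 2 * (u • p + v • q) s a + ∑ b, (u • p + v • q) s b ^ 2))
      ≤ x s a * (1 / 2 * (1 - 2 * (u * p s a + v * q s a) +
          (u * ∑ b, p s b ^ 2 + v * ∑ b, q s b ^ 2))) := by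
        rw [hlin]
        refine mul_le_mul_of_nonneg_left ?_ (hx s a)
        linarith
    _ = _ := by linear_combination (-(1 / 2) * x s a) * huv

lemma continuous_occupancyScore_left (x : S → A → ℝ) :
    Continuous fun p => occupancyScore p x := by
  unfold occupancyScore
  fun_prop

lemma continuous_occupancyScore_right (p : S → A → ℝ) : Continuous (occupancyScore p) := by
  unfold occupancyScore
  fun_prop

end Score

/-! ### Brier risk against entropy, and the saddle point. -/

section Minimax

variable {S A : Type*} {k : ℕ} [Fintype A]

lemma brier_eq (π : Policy S A) (s : S) (a : A) :
    brier π s a = 1 / 2 * (1 - 2 * π.prob s a + ∑ b, π.prob s b ^ 2) := by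
  classical
  have h : ∀ b, (1 / 2 : ℝ) * ((if b = a then 1 else 0) - π.prob s b) ^ 2 =
      (if b = a then 1 / 2 * (1 - 2 * π.prob s b) else 0) + 1 / 2 * π.prob s b ^ 2 := fun b => by
    split_ifs <;> ring
  rw [brier, Finset.sum_congr rfl fun b _ => by convert h b, Finset.sum_add_distrib,
    Finset.sum_ite_eq' Finset.univ a, ← Finset.mul_sum, if_pos (Finset.mem_univ a)]
  ring

variable [Fintype S] [MeasurableSpace S] [MeasurableSpace A]
  [MeasurableSingletonClass S] [MeasurableSingletonClass A]

lemma brierRisk_eq_occupancyScore (M : MDP S A k) (π' π : Policy S A) :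
    brierRisk M π' π = occupancyScore π.prob (occupancy M π') := by
  simp_rw [brierRisk, expect_eq_sum, brier_eq, occupancyScore]

/-- The Brier risk exceeds the causal Tsallis entropy of nature's policy by the expected squared
distance between the two policies. -/
lemma brierRisk_eq_tsallis_add (M : MDP S A k) (π' π : Policy S A) :
    brierRisk M π' π = tsallis M π' +
      1 / 2 * ∑ s, visitation M π' s * ∑ a, (π'.prob s a - π.prob s a) ^ 2 := by
  rw [brierRisk_eq_occupancyScore, tsallis, expect_eq_sum, occupancyScore, ← mul_add,
    ← Finset.sum_add_distrib, Finset.mul_sum]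
  refine Finset.sum_congr rfl fun s _ => ?_
  simp_rw [occupancy_eq_visitation_mul]
  have h1 : ∑ a, visitation M π' s * π'.prob s a *
        (1 / 2 * (1 - 2 * π.prob s a + ∑ b, π.prob s b ^ 2)) =
      1 / 2 * (visitation M π' s * (1 - 2 * ∑ a, π'.prob s a * π.prob s a +
        ∑ b, π.prob s b ^ 2)) := by
    have h : ∀ a, visitation M π' s * π'.prob s a *
        (1 / 2 * (1 - 2 * π.prob s a + ∑ b, π.prob s b ^ 2)) =
        1 / 2 * visitation M π' s * (1 + ∑ b, π.prob s b ^ 2) * π'.prob s a -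
          visitation M π' s * (π'.prob s a * π.prob s a) := fun a => by ring
    rw [Finset.sum_congr rfl fun a _ => h a, Finset.sum_sub_distrib, ← Finset.mul_sum,
      ← Finset.mul_sum, π'.sum_prob]
    ring
  have h2 : ∑ a, visitation M π' s * π'.prob s a * (1 - π'.prob s a) =
      visitation M π' s * (1 - ∑ a, π'.prob s a ^ 2) := by
    have h : ∀ a, visitation M π' s * π'.prob s a * (1 - π'.prob s a) =
        visitation M π' s * π'.prob s a - visitation M π' s * π'.prob s a ^ 2 := fun a => by ring
    rw [Finset.sum_congr rfl fun a _ => h a, Finset.sum_sub_distrib, ← Finset.mul_sum,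
      ← Finset.mul_sum, π'.sum_prob]
    ring
  have h3 : ∑ a, (π'.prob s a - π.prob s a) ^ 2 = ∑ a, π'.prob s a ^ 2 -
      2 * ∑ a, π'.prob s a * π.prob s a + ∑ a, π.prob s a ^ 2 := by
    rw [Finset.mul_sum, ← Finset.sum_sub_distrib, ← Finset.sum_add_distrib]
    exact Finset.sum_congr rfl fun a _ => by ring
  rw [h1, h2, h3]
  ring

lemma brierRisk_self (M : MDP S A k) (π : Policy S A) : brierRisk M π π = tsallis M π := by
  simp [brierRisk_eq_tsallis_add]

lemma tsallis_le_brierRisk (M : MDP S A k) (π' π : Policy S A) :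
    tsallis M π' ≤ brierRisk M π' π := by
  rw [brierRisk_eq_tsallis_add]
  have := Finset.sum_nonneg fun s (_ : s ∈ Finset.univ) => mul_nonneg (visitation_nonneg M π' s)
    (Finset.sum_nonneg fun a (_ : a ∈ Finset.univ) => sq_nonneg (π'.prob s a - π.prob s a))
  linarith

lemma brierRisk_congr (M : MDP S A k) {π' π₁ π₂ : Policy S A}
    (h : ∀ s, 0 < visitation M π' s → π₁ s = π₂ s) : brierRisk M π' π₁ = brierRisk M π' π₂ := by
  simp_rw [brierRisk_eq_tsallis_add]
  congr 2
  refine Finset.sum_congr rfl fun s _ => ?_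
  rcases (visitation_nonneg M π' s).eq_or_lt with h0 | h0
  · simp [← h0]
  · simp [Policy.prob, h s h0]

/-- Equality case: the weighted squared distance must vanish term by term. -/
lemma eq_of_brierRisk_le_tsallis (M : MDP S A k) {π' π : Policy S A}
    (h : brierRisk M π' π ≤ tsallis M π') (s : S) (hs : 0 < visitation M π' s) : π s = π' s := by
  rw [brierRisk_eq_tsallis_add] at h
  have hn : ∀ t, 0 ≤ ∑ a, (π'.prob t a - π.prob t a) ^ 2 :=
    fun t => Finset.sum_nonneg fun a _ => sq_nonneg _
  have hn' : ∀ t ∈ Finset.univ, 0 ≤ visitation M π' t * ∑ a, (π'.prob t a - π.prob t a) ^ 2 :=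
    fun t _ => mul_nonneg (visitation_nonneg M π' t) (hn t)
  have h0 := (Finset.sum_eq_zero_iff_of_nonneg hn').1
    (le_antisymm (by linarith) (Finset.sum_nonneg hn')) s (Finset.mem_univ s)
  have h1 := (mul_eq_zero.1 h0).resolve_left hs.ne'
  ext a
  have h2 := (Finset.sum_eq_zero_iff_of_nonneg fun a _ => sq_nonneg _).1 h1 a (Finset.mem_univ a)
  have h3 : π'.prob s a = π.prob s a := sub_eq_zero.1 (pow_eq_zero_iff two_ne_zero |>.1 h2)
  exact ((ENNReal.toReal_eq_toReal_iff' (PMF.apply_ne_top _ _) (PMF.apply_ne_top _ _)).1 h3).symm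

/-- The occupancy of `π'` also factors through `π`, because unvisited states carry no mass;
uniqueness for the flow equations concludes. Nothing about the states `π` visits is needed. -/
lemma occupancy_congr (M : MDP S A k) {π' π : Policy S A}
    (h : ∀ s, 0 < visitation M π' s → π s = π' s) : occupancy M π = occupancy M π' := by
  refine ((isFlow_occupancy M π').eq_occupancy fun s a => ?_).symm
  rw [← visitation_eq_sum, occupancy_eq_visitation_mul]
  rcases (visitation_nonneg M π' s).eq_or_lt with h0 | h0
  · simp [← h0]
  · simp [Policy.prob, h s h0]

lemma isGreatest_worstBrier (M : MDP S A k) (πE π : Policy S A) :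
    IsGreatest ((fun π' => brierRisk M π' π) '' Matching M πE) (worstBrier M πE π) := by
  have h : (fun π' => brierRisk M π' π) '' Matching M πE = occupancyScore π.prob ''
      flowPolytope M fun j => expect M πE fun s a => M.φ s a j := by
    rw [← occupancy_image_matching, Set.image_image]
    simp_rw [brierRisk_eq_occupancyScore]
  have hc : IsCompact ((fun π' => brierRisk M π' π) '' Matching M πE) := by
    rw [h]
    exact (isCompact_flowPolytope M _).image (continuous_occupancyScore_right π.prob)
  exact hc.isGreatest_sSup ⟨_, πE, fun _ => rfl, rfl⟩

lemma worstBrier_le_iff (M : MDP S A k) (πE π : Policy S A) (v : ℝ) :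
    worstBrier M πE π ≤ v ↔ ∀ π' ∈ Matching M πE, brierRisk M π' π ≤ v := by
  rw [isLUB_le_iff (isGreatest_worstBrier M πE π).isLUB]
  simp [upperBounds]

/-- The Brier risk has a saddle point, by Sion's theorem on the polytope of occupancies. -/
lemma exists_saddlePoint (M : MDP S A k) (πE : Policy S A) :
    ∃ π₁ : Policy S A, ∃ π₂ ∈ Matching M πE, ∀ π' ∈ Matching M πE, ∀ π,
      brierRisk M π' π₁ ≤ brierRisk M π₂ π := by
  -- The minimizing variable runs over the whole policy simplex, so the resulting `π₁` is not yet
  -- known to match the features.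
  obtain ⟨p, hp, x, hx, hsaddle⟩ := Sion.exists_isSaddlePointOn
    (X := policySimplex S A) (Y := flowPolytope M fun j => expect M πE fun s a => M.φ s a j)
    (f := occupancyScore) ⟨_, πE.prob_mem_policySimplex⟩ convex_policySimplex
    isCompact_policySimplex
    (fun x _ => (continuous_occupancyScore_left x).continuousOn.lowerSemicontinuousOn)
    (fun x hx => (convexOn_occupancyScore hx.1 convex_policySimplex).quasiconvexOn)
    (convex_flowPolytope M _) ⟨_, (mem_matching_iff M πE πE).1 fun _ => rfl⟩
    (isCompact_flowPolytope M _)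
    (fun p _ => (continuous_occupancyScore_right p).continuousOn.upperSemicontinuousOn)
    (fun p _ => (concaveOn_occupancyScore p (convex_flowPolytope M _)).quasiconcaveOn)
  obtain ⟨π₁, rfl⟩ := exists_policy_prob_eq hp
  rw [← occupancy_image_matching] at hx
  obtain ⟨π₂, hπ₂, rfl⟩ := hx
  refine ⟨π₁, π₂, hπ₂, fun π' hπ' π => ?_⟩
  rw [brierRisk_eq_occupancyScore, brierRisk_eq_occupancyScore]
  exact hsaddle _ π.prob_mem_policySimplex _ ((mem_matching_iff M πE π').1 hπ')

lemma isMCTE_iff (M : MDP S A k) (πE : Policy S A) {α : ℝ} (hα : 0 < α) (π : Policy S A) :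
    IsMCTE M πE α π ↔
      π ∈ Matching M πE ∧ ∀ π' ∈ Matching M πE, tsallis M π' ≤ tsallis M π := by
  simp only [IsMCTE, mul_le_mul_iff_right₀ hα]

/-- A policy whose worst-case risk is at most the entropy of a maximum entropy policy `π'` agrees
with `π'` where the latter visits, and has maximum entropy itself. -/
lemma isMCTE_of_worstBrier_le (M : MDP S A k) {πE : Policy S A} {α : ℝ} (hα : 0 < α)
    {π' π : Policy S A} (hπ' : IsMCTE M πE α π') (h : worstBrier M πE π ≤ tsallis M π') :
    (∀ s, 0 < visitation M π' s → π s = π' s) ∧ IsMCTE M πE α π := by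
  rw [isMCTE_iff M πE hα] at hπ'
  have hagree := eq_of_brierRisk_le_tsallis M ((worstBrier_le_iff M πE π _).1 h π' hπ'.1)
  have hocc := occupancy_congr M hagree
  refine ⟨hagree, (isMCTE_iff M πE hα π).2 ⟨?_, fun π'' hπ'' => (hπ'.2 π'' hπ'').trans ?_⟩⟩
  · rw [mem_matching_iff, hocc, ← mem_matching_iff]
    exact hπ'.1
  -- Equal occupancies turn the entropy of `π`, which is its risk against itself, into its risk
  -- against `π'`.
  · rw [← brierRisk_self M π, brierRisk_eq_occupancyScore, hocc, ← brierRisk_eq_occupancyScore]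
    exact tsallis_le_brierRisk M π' π

end Minimax

end MCTE

theorem theorem5 {S A : Type*} {k : ℕ} [Finite S] [Fintype A]
    [MeasurableSpace S] [MeasurableSpace A]
    [MeasurableSingletonClass S] [MeasurableSingletonClass A]
    (M : MCTE.MDP S A k) (πE : MCTE.Policy S A) (α : ℝ) (hα : 0 < α) :
    -- the inner maximum over the nature's policies is attained, for every decision maker
    (∀ π : MCTE.Policy S A,
      IsGreatest ((fun π' => MCTE.brierRisk M π' π) '' MCTE.Matching M πE)
        (MCTE.worstBrier M πE π)) ∧
    -- a maximum causal Tsallis entropy policy is robust Bayes, both among the policies that match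
    -- the features and among all policies, if it visits whatever a matching policy can visit
    (∀ π : MCTE.Policy S A, MCTE.IsMCTE M πE α π →
      (∀ π' ∈ MCTE.Matching M πE, ∀ s, 0 < MCTE.visitation M π' s → 0 < MCTE.visitation M π s) →
      MCTE.IsRobustBayes M πE (MCTE.Matching M πE) π ∧
        MCTE.IsRobustBayes M πE Set.univ π) ∧
    -- without that condition, it is so after a change of its values at states it never visits
    (∀ π : MCTE.Policy S A, MCTE.IsMCTE M πE α π →
      ∃ π₁ : MCTE.Policy S A, (∀ s, 0 < MCTE.visitation M π s → π₁ s = π s) ∧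
        MCTE.IsMCTE M πE α π₁ ∧
        MCTE.IsRobustBayes M πE (MCTE.Matching M πE) π₁ ∧
        MCTE.IsRobustBayes M πE Set.univ π₁) ∧
    -- conversely, every robust Bayes policy is a maximum causal Tsallis entropy policy
    (∀ π : MCTE.Policy S A,
      MCTE.IsRobustBayes M πE (MCTE.Matching M πE) π ∨ MCTE.IsRobustBayes M πE Set.univ π →
        MCTE.IsMCTE M πE α π) ∧
    -- against a known nature `π'` the least risk is `W(π')`, attained at `π'` itself
    (∀ π' : MCTE.Policy S A,
      IsLeast (Set.range fun π => MCTE.brierRisk M π' π) (MCTE.tsallis M π') ∧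
        MCTE.brierRisk M π' π' = MCTE.tsallis M π') ∧
    -- the min-max value, with either decision set, is the maximum of `W` under the constraint
    (∃ v : ℝ, IsGreatest (MCTE.tsallis M '' MCTE.Matching M πE) v ∧
      IsLeast (MCTE.worstBrier M πE '' MCTE.Matching M πE) v ∧
      IsLeast (Set.range (MCTE.worstBrier M πE)) v) := by
  cases nonempty_fintype S
  obtain ⟨π₁, π₂, hπ₂, hsaddle⟩ := MCTE.exists_saddlePoint M πE
  have hle : ∀ π' ∈ MCTE.Matching M πE, MCTE.brierRisk M π' π₁ ≤ MCTE.tsallis M π₂ :=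
    fun π' hπ' => (hsaddle π' hπ' π₂).trans_eq (MCTE.brierRisk_self M π₂)
  have hmax : ∀ π' ∈ MCTE.Matching M πE, MCTE.tsallis M π' ≤ MCTE.tsallis M π₂ :=
    fun π' hπ' => (MCTE.tsallis_le_brierRisk M π' π₁).trans (hle π' hπ')
  have hmcte₂ : MCTE.IsMCTE M πE α π₂ := (MCTE.isMCTE_iff M πE hα π₂).2 ⟨hπ₂, hmax⟩
  have hworst₁ : MCTE.worstBrier M πE π₁ ≤ MCTE.tsallis M π₂ :=
    (MCTE.worstBrier_le_iff M πE π₁ _).2 hle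
  have hlower : ∀ π, MCTE.tsallis M π₂ ≤ MCTE.worstBrier M πE π := fun π =>
    (MCTE.tsallis_le_brierRisk M π₂ π).trans
      ((MCTE.isGreatest_worstBrier M πE π).2 ⟨π₂, hπ₂, rfl⟩)
  have hmcte₁ : MCTE.IsMCTE M πE α π₁ :=
    (MCTE.isMCTE_of_worstBrier_le M hα hmcte₂ hworst₁).2
  have hvalue : ∀ π, MCTE.IsMCTE M πE α π → MCTE.tsallis M π = MCTE.tsallis M π₂ := fun π hπ =>
    le_antisymm (hmax π hπ.1) (((MCTE.isMCTE_iff M πE hα π).1 hπ).2 π₂ hπ₂)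
  -- A single `π₁` agrees with every maximizer on that maximizer's visited states.
  have hagree : ∀ π, MCTE.IsMCTE M πE α π → ∀ s, 0 < MCTE.visitation M π s → π₁ s = π s :=
    fun π hπ => (MCTE.isMCTE_of_worstBrier_le M hα hπ (hworst₁.trans_eq (hvalue π hπ).symm)).1
  have hbayes : ∀ π, π ∈ MCTE.Matching M πE → MCTE.worstBrier M πE π ≤ MCTE.tsallis M π₂ →
      MCTE.IsRobustBayes M πE (MCTE.Matching M πE) π ∧ MCTE.IsRobustBayes M πE Set.univ π :=
    fun π hπ hw => ⟨⟨hπ, fun π' _ => hw.trans (hlower π')⟩,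
      ⟨Set.mem_univ π, fun π' _ => hw.trans (hlower π')⟩⟩
  refine ⟨MCTE.isGreatest_worstBrier M πE, fun π hπ hvisit => hbayes π hπ.1 ?_, fun π hπ =>
    ⟨π₁, hagree π hπ, hmcte₁, hbayes π₁ hmcte₁.1 hworst₁⟩, fun π hπ => ?_, fun π' =>
    ⟨⟨⟨π', MCTE.brierRisk_self M π'⟩, ?_⟩, MCTE.brierRisk_self M π'⟩,
    MCTE.tsallis M π₂, ⟨⟨π₂, hπ₂, rfl⟩, ?_⟩, ⟨⟨π₁, hmcte₁.1, ?_⟩, ?_⟩, ⟨⟨π₁, ?_⟩, ?_⟩⟩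
  -- Under the visiting condition `π` equals `π₁` wherever nature can go, so both have the same risk
  -- against each matching policy.
  · refine (MCTE.worstBrier_le_iff M πE π _).2 fun π' hπ' => ?_
    rw [← MCTE.brierRisk_congr M fun s hs => hagree π hπ s (hvisit π' hπ' s hs)]
    exact hle π' hπ'
  · refine (MCTE.isMCTE_of_worstBrier_le M hα hmcte₂ ?_).2
    rcases hπ with hπ | hπ
    · exact (hπ.2 π₁ hmcte₁.1).trans hworst₁
    · exact (hπ.2 π₁ (Set.mem_univ π₁)).trans hworst₁
  · rintro _ ⟨π, rfl⟩
    exact MCTE.tsallis_le_brierRisk M π' π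
  · rintro _ ⟨π, hπ, rfl⟩
    exact hmax π hπ
  · exact le_antisymm hworst₁ (hlower π₁)
  · rintro _ ⟨π, -, rfl⟩
    exact hlower π
  · exact le_antisymm hworst₁ (hlower π₁)
  · rintro _ ⟨π, rfl⟩
    exact hlower π
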